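/- Theorem 4.7. Every unital simple TAI $C^*$-algebra $A$ has the following Fundamental Comparability property of Blackadar: if $p,q\in A$ are two projections with $\tau(p)<\tau(q)$ for all tracial states $\tau$ on $A$, then $p\preceq q$. Here projections are self-adjoint idempotents, and the following definitions are used. (a) A $C^*$-algebra is simple if it is nonzero and its only closed two-sided ideals are $0$ and itself. An element $a\in A$ is full if the closed two-sided ideal it generates is $A$. (b) Projections $p,q\in A$ are (Murray–von Neumann) equivalent, $p\sim q$, if $v^*v=p$ and $vv^*=q$ for some $v\in A$; $p\preceq q$ means that $p$ is equivalent to a projection in $qAq$. For a positive element $a\in A_+$, $p\preceq a$ means that $p\preceq q$ for some projection $q\in\overline{aAa}$. For an integer $n>0$, $n[e]\le[p]$ means that $pAp$ contains $n$ mutually orthogonal projections, each equivalent to $e$. (c) $\mathcal I$ is the class of unital $C^*$-algebras isomorphic to a finite direct sum $\bigoplus_i B_i$ in which each $B_i$ is $M_k$ or $M_k(C([0,1]))$ for some integer $k\ge1$ depending on $i$, where $M_k=M_k(\mathbb C)$. (d) A unital $C^*$-algebra $A$ is TAI (tracially AI) if for every finite subset $\mathcal F\subset A$ containing a nonzero element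 $b$, every $\varepsilon>0$, every integer $n>0$ and every full element $a\in A_+$, there exist a nonzero projection $p\in A$ and a $C^*$-subalgebra $I\subset A$ with $I\in\mathcal I$ and $1_I=p$ such that (1) $\|xp-px\|<\varepsilon$ for all $x\in\mathcal F$; (2) for every $x\in\mathcal F$ there is $y\in I$ with $\|pxp-y\|<\varepsilon$, and $\|pbp\|\ge\|b\|-\varepsilon$; (3) $n[1-p]\le[p]$ and $1-p\preceq a$. (e) A tracial state on $A$ is a positive linear functional $\tau:A\to\mathbb C$ with $\tau(1)=1$ and $\tau(xy)=\tau(yx)$ for all $x,y\in A$. -/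

import Mathlib

open scoped ComplexOrder

/-- A C⋆-algebra is simple if it is nonzero and its only closed two-sided ideals are `0` and the
whole algebra. -/
def IsSimpleCStar (A : Type*) [CStarAlgebra A] : Prop :=
  Nontrivial A ∧ ∀ J : TwoSidedIdeal A, IsClosed (J : Set A) → J = ⊥ ∨ J = ⊤

/-- An element is full if the closed two-sided ideal that it generates is the whole algebra. -/
def IsFullElement {A : Type*} [CStarAlgebra A] (a : A) : Prop :=
  ∀ J : TwoSidedIdeal A, IsClosed (J : Set A) → a ∈ J → J = ⊤

/-- Murray–von Neumann equivalence `p ∼ q` (for projections `p`, `q`). -/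
def MvNEquiv {A : Type*} [CStarAlgebra A] (p q : A) : Prop :=
  ∃ v : A, star v * v = p ∧ v * star v = q

/-- The set `aAa`. -/
def cornerSet {A : Type*} [CStarAlgebra A] (a : A) : Set A :=
  Set.range fun x : A => a * x * a

/-- `p ⪯ q` for projections: `p` is equivalent to a projection in `qAq`. -/
def MvNSubequiv {A : Type*} [CStarAlgebra A] (p q : A) : Prop :=
  ∃ e : A, IsStarProjection e ∧ e ∈ cornerSet q ∧ MvNEquiv p e

/-- `p ⪯ a` for a projection `p` and a positive element `a`: `p ⪯ q` for some projection `q` in the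
hereditary subalgebra `closure (aAa)`. -/
def SubequivPos {A : Type*} [CStarAlgebra A] (p a : A) : Prop :=
  ∃ q : A, IsStarProjection q ∧ q ∈ closure (cornerSet a) ∧ MvNSubequiv p q

/-- `n[e] ≤ [p]` for projections `e`, `p`: the corner `pAp` contains `n` mutually orthogonal
projections, each equivalent to `e`. -/
def MulClassLE {A : Type*} [CStarAlgebra A] (n : ℕ) (e p : A) : Prop :=
  ∃ f : Fin n → A,
    (∀ i, IsStarProjection (f i) ∧ f i ∈ cornerSet p ∧ MvNEquiv e (f i)) ∧
    ∀ i j, i ≠ j → f i * f j = 0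

/-- The finite direct sum of the full matrix algebras `M_{k i}(ℂ)`, `i < m`, and of the algebras
`M_{l j}(C([0,1]))`, `j < n`. -/
abbrev IntervalSum (m n : ℕ) (k : Fin m → ℕ) (l : Fin n → ℕ) : Type :=
  (∀ i : Fin m, Matrix (Fin (k i)) (Fin (k i)) ℂ) ×
    (∀ j : Fin n, Matrix (Fin (l j)) (Fin (l j)) C(unitInterval, ℂ))

/-- `I` is a C⋆-subalgebra of `A`, with unit `p`, that is ⋆-isomorphic to a finite direct sum of
algebras of the forms `M_k(ℂ)` and `M_k(C([0,1]))`, `k ≥ 1`. (A ⋆-isomorphism of C⋆-algebras is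
automatically isometric.) -/
structure IsIntervalSubalgebra {A : Type*} [CStarAlgebra A] (I : NonUnitalStarSubalgebra ℂ A)
    (p : A) : Prop where
  isClosed : IsClosed (I : Set A)
  unit_mem : p ∈ I
  unit_mul : ∀ x ∈ I, p * x = x
  mul_unit : ∀ x ∈ I, x * p = x
  exists_equiv : ∃ (m n : ℕ) (k : Fin m → ℕ) (l : Fin n → ℕ),
    (∀ i, 0 < k i) ∧ (∀ j, 0 < l j) ∧ Nonempty (I ≃⋆ₐ[ℂ] IntervalSum m n k l)

/-- A unital C⋆-algebra is tracially AI (TAI). -/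
def IsTAI (A : Type*) [CStarAlgebra A] [PartialOrder A] [StarOrderedRing A] : Prop :=
  ∀ (F : Finset A) (b : A), b ∈ F → b ≠ 0 →
  ∀ ε : ℝ, 0 < ε → ∀ n : ℕ, 0 < n → ∀ a : A, 0 ≤ a → IsFullElement a →
    ∃ (p : A) (I : NonUnitalStarSubalgebra ℂ A),
      IsStarProjection p ∧ p ≠ 0 ∧ IsIntervalSubalgebra I p ∧
      (∀ x ∈ F, ‖x * p - p * x‖ < ε) ∧
      (∀ x ∈ F, ∃ y ∈ I, ‖p * x * p - y‖ < ε) ∧ ‖b‖ - ε ≤ ‖p * b * p‖ ∧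
      MulClassLE n (1 - p) p ∧ SubequivPos (1 - p) a

/-- Tracial states: positive linear functionals `τ` with `τ 1 = 1` and `τ (xy) = τ (yx)`. -/
structure TracialState (A : Type*) [CStarAlgebra A] [PartialOrder A] [StarOrderedRing A]
    extends A →ₚ[ℂ] ℂ where
  map_one' : toFun 1 = 1
  tracial' : ∀ x y : A, toFun (x * y) = toFun (y * x)

/-!
The theorem follows from an approximate comparison inside interval subalgebras and a compactness
argument for traces.

Let `p`, `q` be projections with `τ p < τ q` for all tracial states. The TAI property gives
projections `e` and interval subalgebras `S` with unit `e` such that `e` almost commutes with `p` and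
`q`, and `e p e`, `e q e` are close to projections `P`, `Q` of `S`
(`exists_isStarProjection_near_compress`). In a direct sum of algebras `M_k` and `M_k(C([0,1]))`
projections are compared by their ranks, since projections over `[0,1]` are equivalent to constant
ones; so either `P` is subequivalent to `Q`, or a normalized fibre trace of `S` is larger at `P` than
at `Q` (`IntervalSum.projSub_or_exists_fibre`). Extended to the whole algebra by Hahn–Banach and
compressed by `e`, such a fibre trace is an almost tracial functional. If the second case occurred
for arbitrarily good approximations, a weak-⋆ limit would be a tracial state `τ` with `τ q ≤ τ p`
(`exists_tracialState_of_approx`). Hence `p` is subequivalent to `P + (1 - e)` with `P`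
subequivalent to `q` (`IsTAI.exists_comparison`); what remains is to find room for `1 - e`.

If `1 - e` can be taken to be zero, this already proves the claim. Otherwise `n [1 - e] ≤ [e]` and
`1 - e ⪯ q` provide nonzero projections `r ≤ q` of uniformly small trace, and by compactness
`τ p < τ (q - r)` for all `τ` for one of them (`exists_forall_tracialState_lt_sub`). The approximate
comparison of `p` with `q - r`, with `1 - e ⪯ r` this time, gives
`p ⪯ P + (1 - e) ⪯ (q - r) + r = q`.
-/

/-! ### Subequivalence of projections in ⋆-rings -/

/-- Murray–von Neumann subequivalence of projections in an arbitrary (possibly non-unital) ⋆-ring: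
there is a partial isometry `v` with initial projection `p` and with range below `q`. In contrast to
`MvNSubequiv` it is visibly transported by ⋆-homomorphisms and computed coordinatewise in
products. In a C⋆-algebra the condition `v * p = v` would follow from `star v * v = p`. -/
def ProjSub {R : Type*} [Mul R] [Star R] (p q : R) : Prop :=
  ∃ v : R, star v * v = p ∧ v * p = v ∧ q * v = v

namespace ProjSub

section Ring

variable {R : Type*} [NonUnitalRing R] [StarRing R]

theorem of_mul_eq {p q : R} (hp : IsStarProjection p) (h : q * p = p) : ProjSub p q :=
  ⟨p, by rw [hp.isSelfAdjoint.star_eq, hp.isIdempotentElem.eq], hp.isIdempotentElem.eq, h⟩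

theorem trans {p q r : R} (hpq : ProjSub p q) (hqr : ProjSub q r) : ProjSub p r := by
  obtain ⟨v, hv1, hv2, hv3⟩ := hpq
  obtain ⟨w, hw1, hw2, hw3⟩ := hqr
  refine ⟨w * v, ?_, ?_, ?_⟩
  · rw [star_mul, mul_assoc, ← mul_assoc (star w), hw1, hv3, hv1]
  · rw [mul_assoc, hv2]
  · rw [← mul_assoc, hw3]

theorem add {p₁ p₂ q₁ q₂ : R} (hp₁ : IsStarProjection p₁) (hp₂ : IsStarProjection p₂)
    (hq₁ : IsStarProjection q₁) (hq₂ : IsStarProjection q₂) (hp : p₁ * p₂ = 0) (hq : q₁ * q₂ = 0)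
    (h₁ : ProjSub p₁ q₁) (h₂ : ProjSub p₂ q₂) : ProjSub (p₁ + p₂) (q₁ + q₂) := by
  obtain ⟨v, hv1, hv2, hv3⟩ := h₁
  obtain ⟨w, hw1, hw2, hw3⟩ := h₂
  have hp' : p₂ * p₁ = 0 := by
    simpa [hp₁.isSelfAdjoint.star_eq, hp₂.isSelfAdjoint.star_eq] using congrArg star hp
  have hq' : q₂ * q₁ = 0 := by
    simpa [hq₁.isSelfAdjoint.star_eq, hq₂.isSelfAdjoint.star_eq] using congrArg star hq
  have hvw : star v * w = 0 := by
    rw [← hv3, ← hw3, star_mul, hq₁.isSelfAdjoint.star_eq, mul_assoc, ← mul_assoc q₁, hq]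
    simp
  have hwv : star w * v = 0 := by simpa using congrArg star hvw
  refine ⟨v + w, ?_, ?_, ?_⟩
  · rw [star_add, add_mul, mul_add, mul_add, hvw, hwv, hv1, hw1]; simp
  · have h1 : v * p₂ = 0 := by rw [← hv2, mul_assoc, hp, mul_zero]
    have h2 : w * p₁ = 0 := by rw [← hw2, mul_assoc, hp', mul_zero]
    rw [add_mul, mul_add, mul_add, h1, h2, hv2, hw2]; simp
  · have h1 : q₂ * v = 0 := by rw [← hv3, ← mul_assoc, hq', zero_mul]
    have h2 : q₁ * w = 0 := by rw [← hw3, ← mul_assoc, hq, zero_mul]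
    rw [add_mul, mul_add, mul_add, h1, h2, hv3, hw3]; simp

end Ring

theorem map {R S F : Type*} [Mul R] [Star R] [Mul S] [Star S] [FunLike F R S]
    [MulHomClass F R S] [StarHomClass F R S] (f : F) {p q : R} (h : ProjSub p q) :
    ProjSub (f p) (f q) := by
  obtain ⟨v, hv1, hv2, hv3⟩ := h
  exact ⟨f v, by rw [← map_star, ← map_mul, hv1], by rw [← map_mul, hv2], by rw [← map_mul, hv3]⟩

theorem prod {R S : Type*} [Mul R] [Star R] [Mul S] [Star S] {p q : R × S}
    (h₁ : ProjSub p.1 q.1) (h₂ : ProjSub p.2 q.2) : ProjSub p q := by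
  obtain ⟨v, hv1, hv2, hv3⟩ := h₁
  obtain ⟨w, hw1, hw2, hw3⟩ := h₂
  exact ⟨(v, w), Prod.ext hv1 hw1, Prod.ext hv2 hw2, Prod.ext hv3 hw3⟩

theorem pi {ι : Type*} {R : ι → Type*} [∀ i, Mul (R i)] [∀ i, Star (R i)] {p q : ∀ i, R i}
    (h : ∀ i, ProjSub (p i) (q i)) : ProjSub p q := by
  choose v hv1 hv2 hv3 using h
  exact ⟨v, funext hv1, funext hv2, funext hv3⟩

end ProjSub

section CStar

variable {A : Type*} [CStarAlgebra A]

theorem mul_eq_self_of_star_mul_self {p v : A} (hp : IsStarProjection p) (h : star v * v = p) :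
    v * p = v := by
  have h0 : star (v * p - v) * (v * p - v) = 0 := by
    have : star (v * p - v) * (v * p - v)
        = p * (star v * v) * p - p * (star v * v) - (star v * v) * p + star v * v := by
      rw [star_sub, star_mul, hp.isSelfAdjoint.star_eq]; noncomm_ring
    rw [this, h]
    simp [hp.isIdempotentElem.eq]
  exact sub_eq_zero.mp (CStarRing.star_mul_self_eq_zero_iff _ |>.mp h0)

/-- The range projection of a partial isometry witnessing `ProjSub p q`. -/
theorem ProjSub.exists_isStarProjection {p q : A} (hq : IsStarProjection q) (h : ProjSub p q) :
    ∃ v : A, star v * v = p ∧ IsStarProjection (v * star v) ∧ q * (v * star v) = v * star v ∧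
      (v * star v) * q = v * star v := by
  obtain ⟨v, hv1, hv2, hv3⟩ := h
  refine ⟨v, hv1, ⟨?_, ?_⟩, ?_, ?_⟩
  · rw [IsIdempotentElem, mul_assoc, ← mul_assoc (star v), hv1, ← mul_assoc, hv2]
  · simp [IsSelfAdjoint]
  · rw [← mul_assoc, hv3]
  · have : star v * q = star v := by
      simpa [hq.isSelfAdjoint.star_eq] using congrArg star hv3
    rw [mul_assoc, this]

theorem ProjSub.mvNSubequiv {p q : A} (hq : IsStarProjection q) (h : ProjSub p q) :
    MvNSubequiv p q := by
  obtain ⟨v, hv1, hv2, hv3, hv4⟩ := h.exists_isStarProjection hq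
  exact ⟨v * star v, hv2, ⟨v * star v, by simp only; rw [hv3, hv4]⟩, v, hv1, rfl⟩

theorem MvNSubequiv.projSub {p q : A} (hp : IsStarProjection p) (hq : IsStarProjection q)
    (h : MvNSubequiv p q) : ProjSub p q := by
  obtain ⟨e, -, ⟨x, rfl⟩, v, hv1, hv2⟩ := h
  refine ⟨v, hv1, mul_eq_self_of_star_mul_self hp hv1, ?_⟩
  have hvp := mul_eq_self_of_star_mul_self hp hv1
  simp only at hv2
  calc q * v = q * (v * star v) * v := by rw [mul_assoc, mul_assoc, hv1, hvp]
    _ = v * star v * v := by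
      rw [hv2, ← mul_assoc, ← mul_assoc, hq.isIdempotentElem.eq]
    _ = v := by rw [mul_assoc, hv1, hvp]

theorem mul_mul_eq_of_mem_closure_cornerSet {q x : A} (hq : IsStarProjection q)
    (hx : x ∈ closure (cornerSet q)) : q * x = x := by
  have hcl : IsClosed {x : A | q * x = x} := isClosed_eq (by fun_prop) continuous_id
  refine closure_minimal ?_ hcl hx
  rintro _ ⟨y, rfl⟩
  simp only [Set.mem_ofPred_eq, ← mul_assoc, hq.isIdempotentElem.eq]

theorem SubequivPos.projSub {p q : A} (hp : IsStarProjection p) (hq : IsStarProjection q)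
    (h : SubequivPos p q) : ProjSub p q := by
  obtain ⟨e, he, heq, hpe⟩ := h
  exact (hpe.projSub hp he).trans (.of_mul_eq he (mul_mul_eq_of_mem_closure_cornerSet hq heq))

/-- A projection `p` that is almost fixed by a projection `f` is subequivalent to `f`. The partial
isometry is the polar part of `f * p`: as `‖p - p f p‖ < 1`, the element `p f p` is invertible in
the corner of `p`, and `f p (p f p)^(-1/2)` is computed with the functional calculus of
`d = p - p f p`. -/
theorem ProjSub.of_norm_sub_lt_one {p f : A} (hp : IsStarProjection p) (hf : IsStarProjection f)
    (h : ‖p - f * p‖ < 1) : ProjSub p f := by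
  have hpi := hp.isIdempotentElem.eq
  have hfi := hf.isIdempotentElem.eq
  have hps := hp.isSelfAdjoint.star_eq
  have hfs := hf.isSelfAdjoint.star_eq
  set d : A := p - p * f * p with hd
  have hdsa : IsSelfAdjoint d := by
    simp [IsSelfAdjoint, hd, hps, hfs, mul_assoc]
  have hdn : ‖d‖ < 1 := by
    have : d = p * (p - f * p) := by rw [hd, mul_sub, hpi, mul_assoc]
    have hp1 : ‖p‖ ≤ 1 := hp.norm_le
    calc ‖d‖ ≤ ‖p‖ * ‖p - f * p‖ := this ▸ norm_mul_le _ _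
      _ ≤ 1 * ‖p - f * p‖ := by gcongr
      _ < 1 := by simpa using h
  have hdp : Commute d p := by
    rw [Commute, SemiconjBy, hd, sub_mul, mul_sub, mul_assoc _ p p, hpi, ← mul_assoc, ← mul_assoc,
      hpi]
  have hspec : ∀ x ∈ spectrum ℝ d, 0 < 1 - x := fun x hx => by
    have hx1 : ‖x‖ ≤ ‖d‖ * ‖(1 : A)‖ := spectrum.norm_le_norm_mul_of_mem hx
    have : ‖(1 : A)‖ ≤ 1 := (IsStarProjection.one (R := A)).norm_le
    have h2 : ‖d‖ * ‖(1 : A)‖ ≤ ‖d‖ := mul_le_of_le_one_right (norm_nonneg _) this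
    have := le_abs_self x
    rw [Real.norm_eq_abs] at hx1
    linarith
  set g : ℝ → ℝ := fun x => (√(1 - x))⁻¹ with hg
  have hgc : ContinuousOn g (spectrum ℝ d) := by
    refine ContinuousOn.inv₀ (by fun_prop) fun x hx => ?_
    exact (Real.sqrt_pos.mpr (hspec x hx)).ne'
  set c : A := cfc g d with hc
  have hcs : star c = c := (cfc_predicate g d : IsSelfAdjoint c).star_eq
  have hcp : Commute c p := hdp.cfc_real g
  have hccd : c * c * (1 - d) = 1 := by
    have h1 : (1 : A) - d = cfc (fun x : ℝ => 1 - x) d := by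
      rw [cfc_sub (fun _ => (1 : ℝ)) (fun x => x) d, cfc_const_one ℝ d, cfc_id' ℝ d]
    rw [h1, hc, ← cfc_mul g g d, ← cfc_mul (fun x => g x * g x) (fun x => 1 - x) d
      (hgc.mul hgc) (by fun_prop)]
    rw [← cfc_const_one ℝ d]
    refine cfc_congr fun x hx => ?_
    have hx' := hspec x hx
    simp only [hg]
    rw [← mul_inv, Real.mul_self_sqrt hx'.le, inv_mul_cancel₀ hx'.ne']
  have hpfp : p * f * p = (1 - d) * p := by
    rw [hd, sub_mul, sub_mul, mul_assoc _ p p, hpi]; simp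
  refine ⟨f * p * c, ?_, ?_, ?_⟩
  · have h1 : star (f * p * c) * (f * p * c) = c * (p * (f * f) * p) * c := by
      rw [star_mul, star_mul, hcs, hps, hfs]; noncomm_ring
    have hcd : Commute c (1 - d) := (Commute.one_right c).sub_right
      ((Commute.refl d).cfc_real g)
    rw [h1, hfi, hpfp, mul_assoc, mul_assoc, ← hcp.eq, ← mul_assoc (1 - d), ← hcd.eq, ← mul_assoc,
      ← mul_assoc, hccd, one_mul]
  · rw [mul_assoc, hcp.eq, ← mul_assoc, mul_assoc f, hpi]
  · rw [← mul_assoc, ← mul_assoc, hfi]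

end CStar

/-- A self-adjoint element that is almost idempotent is close to a projection. -/
theorem exists_isStarProjection_norm_sub_le {B : Type*} [NonUnitalCStarAlgebra B] {y : B}
    (hy : IsSelfAdjoint y) (h : ‖y * y - y‖ ≤ 1 / 8) :
    ∃ p : B, IsStarProjection p ∧ ‖p - y‖ ≤ 2 * ‖y * y - y‖ := by
  -- `f` vanishes on `(-∞, 1/4]` and equals `1` on `[3/4, ∞)`.
  set f : ℝ → ℝ := fun x => max 0 (min 1 (2 * x - 1 / 2)) with hf
  have hfc : Continuous f := by fun_prop
  have hf0 : f 0 = 0 := by norm_num [hf]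
  have hspec : ∀ x ∈ quasispectrum ℝ y, |x * x - x| ≤ ‖y * y - y‖ := fun x hx => by
    have h1 : cfcₙ (fun x : ℝ => x * x - x) y = y * y - y := by
      rw [cfcₙ_sub (fun x : ℝ => x * x) (fun x => x) y, cfcₙ_mul (fun x : ℝ => x) (fun x => x) y,
        cfcₙ_id' ℝ y]
    have := norm_apply_le_norm_cfcₙ (fun x : ℝ => x * x - x) y hx
    rwa [h1, Real.norm_eq_abs] at this
  have hval : ∀ x ∈ quasispectrum ℝ y, (f x = 0 ∧ |x| ≤ 2 * ‖y * y - y‖) ∨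
      (f x = 1 ∧ |1 - x| ≤ 2 * ‖y * y - y‖) := fun x hx => by
    have h1 := hspec x hx
    generalize ‖y * y - y‖ = η at h h1 ⊢
    rw [abs_le] at h1
    rcases le_total x (1 / 2) with hx2 | hx2
    · have h3 : |x| ≤ 2 * η := abs_le.mpr ⟨by nlinarith, by nlinarith⟩
      refine Or.inl ⟨?_, h3⟩
      have := (abs_le.mp h3).2
      simp only [hf]
      rw [min_eq_right (by linarith), max_eq_left (by linarith)]
    · have h3 : |1 - x| ≤ 2 * η := abs_le.mpr ⟨by nlinarith, by nlinarith⟩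
      refine Or.inr ⟨?_, h3⟩
      have := (abs_le.mp h3).2
      simp only [hf]
      rw [min_eq_left (by linarith), max_eq_right (by linarith)]
  refine ⟨cfcₙ f y, ⟨?_, cfcₙ_predicate f y⟩, ?_⟩
  · rw [IsIdempotentElem, ← cfcₙ_mul f f y]
    refine cfcₙ_congr fun x hx => ?_
    rcases hval x hx with h | h <;> simp [h.1]
  · have h1 : cfcₙ f y - y = cfcₙ (fun x => f x - x) y := by
      rw [cfcₙ_sub f (fun x => x) y, cfcₙ_id' ℝ y]
    rw [h1]
    refine norm_cfcₙ_le fun x hx => ?_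
    rcases hval x hx with h | h
    · simpa [h.1] using h.2
    · simpa [h.1] using h.2

/-! ### Comparison of projections by traces in matrix algebras over `ℂ` and `C([0,1])` -/

theorem le_of_antitone_of_sum_le {ι : Type*} [Fintype ι] [LinearOrder ι] {a b : ι → ℝ}
    (ha : Antitone a) (hb : Antitone b) (ha' : ∀ i, a i = 0 ∨ a i = 1)
    (hb' : ∀ i, b i = 0 ∨ b i = 1) (h : ∑ i, a i ≤ ∑ i, b i) (i : ι) : a i ≤ b i := by
  by_contra! hi
  have hai : a i = 1 := by rcases ha' i with h1 | h1 <;> rcases hb' i with h2 | h2 <;> linarith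
  have hbi : b i = 0 := by rcases hb' i with h2 | h2 <;> linarith
  -- `a = 1` up to `i` and `b = 0` from `i` on, so that `b ≤ a` everywhere.
  refine absurd h (not_le.mpr (Finset.sum_lt_sum (fun j _ => ?_) ⟨i, Finset.mem_univ i, hi⟩))
  rcases le_total j i with hji | hji
  · have := ha hji
    rcases ha' j with h1 | h1 <;> rcases hb' j with h2 | h2 <;> linarith
  · have := hb hji
    rcases ha' j with h1 | h1 <;> rcases hb' j with h2 | h2 <;> linarith

theorem Matrix.IsHermitian.eigenvalues_eq_zero_or_one {n : Type*} [Fintype n] [DecidableEq n]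
    {P : Matrix n n ℂ} (hP : P.IsHermitian) (hi : P * P = P) (i : n) :
    hP.eigenvalues i = 0 ∨ hP.eigenvalues i = 1 := by
  have hv := hP.mulVec_eigenvectorBasis i
  have h2 : P.mulVec (P.mulVec (hP.eigenvectorBasis i)) = P.mulVec (hP.eigenvectorBasis i) := by
    rw [Matrix.mulVec_mulVec, hi]
  rw [hv, Matrix.mulVec_smul, hv] at h2
  have hne : (hP.eigenvectorBasis i : EuclideanSpace ℂ n) ≠ 0 :=
    hP.eigenvectorBasis.orthonormal.ne_zero i
  have h3 : (hP.eigenvalues i * hP.eigenvalues i - hP.eigenvalues i) •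
      (hP.eigenvectorBasis i : EuclideanSpace ℂ n) = 0 := by
    ext j
    have := congrFun h2 j
    simp only [Pi.smul_apply, smul_smul] at this
    rw [sub_smul, WithLp.ofLp_sub, Pi.sub_apply]
    simpa using sub_eq_zero.mpr this
  have h4 := (smul_eq_zero.mp h3).resolve_right hne
  have h5 : hP.eigenvalues i * (hP.eigenvalues i - 1) = 0 := by linarith
  rcases mul_eq_zero.mp h5 with h | h
  · exact Or.inl h
  · exact Or.inr (by linarith)

/-- Diagonalize both projections with eigenvalues in decreasing order: the trace inequality makes the
ones of `P` a subset of the ones of `Q`, and the two eigenbases give the partial isometry. -/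
theorem Matrix.projSub_of_trace_le {k : ℕ} {P Q : Matrix (Fin k) (Fin k) ℂ}
    (hP : IsStarProjection P) (hQ : IsStarProjection Q) (h : P.trace.re ≤ Q.trace.re) :
    ProjSub P Q := by
  have hPh : P.IsHermitian := hP.isSelfAdjoint
  have hQh : Q.IsHermitian := hQ.isSelfAdjoint
  have hP01 := hPh.eigenvalues_eq_zero_or_one hP.isIdempotentElem.eq
  have hQ01 := hQh.eigenvalues_eq_zero_or_one hQ.isIdempotentElem.eq
  have hle : ∀ i, hPh.eigenvalues i ≤ hQh.eigenvalues i := by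
    have hsum : ∑ i, hPh.eigenvalues i ≤ ∑ i, hQh.eigenvalues i := by
      rw [hPh.trace_eq_sum_eigenvalues, hQh.trace_eq_sum_eigenvalues] at h
      simpa using h
    let σ : Fin k ≃ Fin (Fintype.card (Fin k)) :=
      (Fintype.equivOfCardEq (Fintype.card_fin _)).symm
    have h1 : ∀ i, hPh.eigenvalues i = hPh.eigenvalues₀ (σ i) := fun i => rfl
    have h2 : ∀ i, hQh.eigenvalues i = hQh.eigenvalues₀ (σ i) := fun i => rfl
    intro i
    rw [h1, h2]
    refine le_of_antitone_of_sum_le hPh.eigenvalues₀_antitone hQh.eigenvalues₀_antitone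
      (fun j => ?_) (fun j => ?_) ?_ _
    · have := hP01 (σ.symm j); rwa [h1, σ.apply_symm_apply] at this
    · have := hQ01 (σ.symm j); rwa [h2, σ.apply_symm_apply] at this
    · rwa [← Equiv.sum_comp σ, ← Equiv.sum_comp σ]
  set U : Matrix (Fin k) (Fin k) ℂ := hPh.eigenvectorUnitary.1
  set W : Matrix (Fin k) (Fin k) ℂ := hQh.eigenvectorUnitary.1
  have hUU : star U * U = 1 := Unitary.coe_star_mul_self hPh.eigenvectorUnitary
  have hWW : star W * W = 1 := Unitary.coe_star_mul_self hQh.eigenvectorUnitary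
  set D : Matrix (Fin k) (Fin k) ℂ := Matrix.diagonal (fun i => (hPh.eigenvalues i : ℂ)) with hD
  set E : Matrix (Fin k) (Fin k) ℂ := Matrix.diagonal (fun i => (hQh.eigenvalues i : ℂ)) with hE
  have hPU : P = U * D * star U := by
    have := hPh.spectral_theorem
    rw [Unitary.conjStarAlgAut_apply] at this
    exact this
  have hQW : Q = W * E * star W := by
    have := hQh.spectral_theorem
    rw [Unitary.conjStarAlgAut_apply] at this
    exact this
  have hDD : D * D = D := by
    rw [hD, Matrix.diagonal_mul_diagonal]
    congr 1; funext i
    rcases hP01 i with h | h <;> simp [h]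
  have hED : E * D = D := by
    rw [hD, hE, Matrix.diagonal_mul_diagonal]
    congr 1; funext i
    have := hle i
    rcases hP01 i with h | h <;> rcases hQ01 i with h' | h' <;> simp [h, h']
    linarith
  have hDs : star D = D := by
    rw [hD, Matrix.star_eq_conjTranspose, Matrix.diagonal_conjTranspose]
    congr 1; funext i; simp
  refine ⟨W * D * star U, ?_, ?_, ?_⟩
  · calc star (W * D * star U) * (W * D * star U) = U * D * (star W * W) * D * star U := by
          rw [star_mul, star_mul, star_star, hDs]; simp only [mul_assoc]
      _ = P := by rw [hWW, mul_one, mul_assoc U, hDD, hPU]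
  · calc W * D * star U * P = W * D * (star U * U) * D * star U := by
          rw [hPU]; simp only [mul_assoc]
      _ = _ := by rw [hUU, mul_one, mul_assoc W, hDD]
  · calc Q * (W * D * star U) = W * E * (star W * W) * D * star U := by
          rw [hQW]; simp only [mul_assoc]
      _ = _ := by rw [hWW, mul_one, mul_assoc W, hED]

section Interval

open scoped unitInterval

/-- A projection `P` in `C([0,1], B)` is subequivalent to the constant projection `P 0` and
conversely: `t ↦ P (t · s)` is a path of projections between them, and projections at distance less
than one are subequivalent to each other. -/
theorem ContinuousMap.projSub_const_zero {B : Type*} [CStarAlgebra B] {P : C(I, B)}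
    (hP : IsStarProjection P) :
    ProjSub P (ContinuousMap.const I (P 0)) ∧ ProjSub (ContinuousMap.const I (P 0)) P := by
  let F : C(I, C(I, B)) := ContinuousMap.curry ⟨fun x : I × I => P (x.1 * x.2), by fun_prop⟩
  have hF : ∀ t s, F t s = P (t * s) := fun t s => rfl
  have hproj : ∀ t, IsStarProjection (F t) := fun t => by
    refine ⟨?_, ?_⟩
    · ext s
      exact congrArg (fun G : C(I, B) => G (t * s)) hP.isIdempotentElem.eq
    · ext s
      exact congrArg (fun G : C(I, B) => G (t * s)) hP.isSelfAdjoint.star_eq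
  have hclose : ∀ t s, ‖F t - F s‖ < 1 → ProjSub (F t) (F s) := fun t s h => by
    refine .of_norm_sub_lt_one (hproj t) (hproj s) ?_
    have h1 : F t - F s * F t = (F t - F s) * F t := by
      rw [sub_mul, (hproj t).isIdempotentElem.eq]
    have h2 : ‖F t‖ ≤ 1 := (hproj t).norm_le
    calc ‖F t - F s * F t‖ ≤ ‖F t - F s‖ * ‖F t‖ := h1 ▸ norm_mul_le _ _
      _ ≤ ‖F t - F s‖ * 1 := by gcongr
      _ < 1 := by simpa using h
  have key : ∀ t s : I, ProjSub (F t) (F s) := fun t s => by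
    refine isPreconnected_univ.induction₂' (fun t s => ProjSub (F t) (F s)) (fun x _ => ?_)
      (fun x y z _ _ _ h h' => h.trans h') (Set.mem_univ t) (Set.mem_univ s)
    rw [nhdsWithin_univ]
    filter_upwards [F.continuous.continuousAt.eventually (Metric.ball_mem_nhds (F x) one_pos)]
      with y hy
    rw [dist_eq_norm] at hy
    exact ⟨hclose _ _ (by rwa [norm_sub_rev]), hclose _ _ hy⟩
  have h1 : F 1 = P := by ext s; rw [hF, one_mul]
  have h0 : F 0 = ContinuousMap.const I (P 0) := by ext s; rw [hF, zero_mul]; rfl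
  rw [← h0]
  exact ⟨by simpa only [h1] using key 1 0, by simpa only [h1] using key 0 1⟩

open scoped Matrix.Norms.L2Operator in
/-- For projections in `M_l(C([0,1]))` it is enough to compare the traces at the endpoint `0`. -/
theorem Matrix.projSub_of_trace_apply_zero_le {l : ℕ} {P Q : Matrix (Fin l) (Fin l) C(I, ℂ)}
    (hP : IsStarProjection P) (hQ : IsStarProjection Q)
    (h : (P.trace 0).re ≤ (Q.trace 0).re) : ProjSub P Q := by
  let T (X : Matrix (Fin l) (Fin l) C(I, ℂ)) : C(I, Matrix (Fin l) (Fin l) ℂ) :=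
    ⟨fun s => Matrix.of fun i j => X i j s, by fun_prop⟩
  have hT : ∀ X s i j, T X s i j = X i j s := fun X s i j => rfl
  have hTmul : ∀ X Y, T (X * Y) = T X * T Y := fun X Y => by
    ext s i j
    rw [hT, ContinuousMap.mul_apply, Matrix.mul_apply, Matrix.mul_apply, ContinuousMap.sum_apply]
    rfl
  have hTstar : ∀ X, T (star X) = star (T X) := fun X => rfl
  have hTinj : Function.Injective T := fun X Y hXY => by
    ext i j s
    rw [← hT X, hXY, hT]
  have hTsurj : Function.Surjective T := fun Z => by
    refine ⟨Matrix.of fun i j => ⟨fun s => Z s i j, ?_⟩, ?_⟩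
    · have : Continuous fun M : Matrix (Fin l) (Fin l) ℂ => M i j := by fun_prop
      exact this.comp Z.continuous
    · ext s i j; rfl
  have hproj : ∀ X, IsStarProjection X → IsStarProjection (T X) := fun X hX =>
    ⟨by rw [IsIdempotentElem, ← hTmul, hX.isIdempotentElem.eq],
      by rw [IsSelfAdjoint, ← hTstar, hX.isSelfAdjoint.star_eq]⟩
  have hval : ∀ X, IsStarProjection X → IsStarProjection (T X 0) := fun X hX =>
    ⟨congrArg (fun G : C(I, Matrix (Fin l) (Fin l) ℂ) => G 0) (hproj X hX).isIdempotentElem.eq,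
      congrArg (fun G : C(I, Matrix (Fin l) (Fin l) ℂ) => G 0) (hproj X hX).isSelfAdjoint.star_eq⟩
  have htr : ∀ X : Matrix (Fin l) (Fin l) C(I, ℂ), (T X 0).trace = X.trace 0 := fun X => by
    simp [Matrix.trace, hT]
  have h0 : ProjSub (T P 0) (T Q 0) :=
    Matrix.projSub_of_trace_le (hval P hP) (hval Q hQ) (by rwa [htr, htr])
  have hc : ProjSub (ContinuousMap.const I (T P 0)) (ContinuousMap.const I (T Q 0)) := by
    obtain ⟨v, hv1, hv2, hv3⟩ := h0
    exact ⟨ContinuousMap.const I v, by ext1 s; exact hv1, by ext1 s; exact hv2,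
      by ext1 s; exact hv3⟩
  obtain ⟨w, hw1, hw2, hw3⟩ := (ContinuousMap.projSub_const_zero (hproj P hP)).1.trans
    (hc.trans (ContinuousMap.projSub_const_zero (hproj Q hQ)).2)
  obtain ⟨v, rfl⟩ := hTsurj w
  exact ⟨v, hTinj (by rw [hTmul, hTstar, hw1]), hTinj (by rw [hTmul, hw2]),
    hTinj (by rw [hTmul, hw3])⟩

end Interval

/-! ### Fibre traces of interval algebras -/

/-- Either `P` is subequivalent to `Q`, or some fibre of the direct sum separates them by its
trace. -/
theorem IntervalSum.projSub_or_exists_fibre {m n : ℕ} {k : Fin m → ℕ} {l : Fin n → ℕ}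
    (hk : ∀ i, 0 < k i) (hl : ∀ j, 0 < l j) {P Q : IntervalSum m n k l}
    (hP : IsStarProjection P) (hQ : IsStarProjection Q) :
    ProjSub P Q ∨ ∃ (d : ℕ) (π : IntervalSum m n k l →⋆ₙₐ[ℂ] Matrix (Fin d) (Fin d) ℂ),
      0 < d ∧ π 1 = 1 ∧ (π Q).trace.re < (π P).trace.re := by
  by_cases h1 : ∀ i, (P.1 i).trace.re ≤ (Q.1 i).trace.re
  · by_cases h2 : ∀ j, ((P.2 j).trace 0).re ≤ ((Q.2 j).trace 0).re
    · refine Or.inl (ProjSub.prod (.pi fun i => ?_) (.pi fun j => ?_))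
      · refine Matrix.projSub_of_trace_le ⟨?_, ?_⟩ ⟨?_, ?_⟩ (h1 i)
        · exact congrArg (fun X : IntervalSum m n k l => X.1 i) hP.isIdempotentElem.eq
        · exact congrArg (fun X : IntervalSum m n k l => X.1 i) hP.isSelfAdjoint.star_eq
        · exact congrArg (fun X : IntervalSum m n k l => X.1 i) hQ.isIdempotentElem.eq
        · exact congrArg (fun X : IntervalSum m n k l => X.1 i) hQ.isSelfAdjoint.star_eq
      · refine Matrix.projSub_of_trace_apply_zero_le ⟨?_, ?_⟩ ⟨?_, ?_⟩ (h2 j)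
        · exact congrArg (fun X : IntervalSum m n k l => X.2 j) hP.isIdempotentElem.eq
        · exact congrArg (fun X : IntervalSum m n k l => X.2 j) hP.isSelfAdjoint.star_eq
        · exact congrArg (fun X : IntervalSum m n k l => X.2 j) hQ.isIdempotentElem.eq
        · exact congrArg (fun X : IntervalSum m n k l => X.2 j) hQ.isSelfAdjoint.star_eq
    · push Not at h2
      obtain ⟨j, hj⟩ := h2
      let π : IntervalSum m n k l →⋆ₙₐ[ℂ] Matrix (Fin (l j)) (Fin (l j)) ℂ :=
        { toFun := fun X => Matrix.of fun a b => X.2 j a b 0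
          map_smul' := fun c X => by ext a b; simp
          map_zero' := by ext a b; simp
          map_add' := fun X Y => by ext a b; simp
          map_mul' := fun X Y => by
            ext a b
            simp [Matrix.mul_apply, ContinuousMap.sum_apply]
          map_star' := fun X => by ext a b; simp [Matrix.star_apply] }
      have htr : ∀ X, (π X).trace = (X.2 j).trace 0 := fun X => by
        simp [Matrix.trace, π, ContinuousMap.sum_apply]
      refine Or.inr ⟨l j, π, hl j, ?_, by rwa [htr, htr]⟩
      ext a b
      by_cases hab : a = b <;> simp [π, Matrix.one_apply, hab]
  · push Not at h1
    obtain ⟨i, hi⟩ := h1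
    let π : IntervalSum m n k l →⋆ₙₐ[ℂ] Matrix (Fin (k i)) (Fin (k i)) ℂ :=
      { toFun := fun X => X.1 i
        map_smul' := fun c X => rfl
        map_zero' := rfl
        map_add' := fun X Y => rfl
        map_mul' := fun X Y => rfl
        map_star' := fun X => rfl }
    exact Or.inr ⟨k i, π, hk i, rfl, hi⟩

open scoped Matrix.Norms.L2Operator in
theorem Matrix.norm_trace_le {d : ℕ} (M : Matrix (Fin d) (Fin d) ℂ) : ‖M.trace‖ ≤ d * ‖M‖ := by
  have h : ∀ i, ‖M i i‖ ≤ ‖M‖ := fun i => by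
    have h1 := Matrix.l2_opNorm_mulVec M (EuclideanSpace.single i (1 : ℂ))
    rw [PiLp.norm_single, norm_one, mul_one] at h1
    refine le_trans ?_ h1
    refine le_trans (le_of_eq ?_) (PiLp.norm_apply_le _ i)
    simp [EuclideanSpace.single]
  calc ‖M.trace‖ ≤ ∑ i : Fin d, ‖M i i‖ := norm_sum_le _ _
    _ ≤ ∑ _i : Fin d, ‖M‖ := Finset.sum_le_sum fun i _ => h i
    _ = d * ‖M‖ := by simp

open scoped Matrix.Norms.L2Operator in
/-- If a projection `P` of an interval subalgebra `S` with unit `e` is not subequivalent to `Q`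
within `S`, then some functional on the ambient algebra restricts to a tracial state of `S` whose
value at `P` is at least the value at `Q`. It is a norm-preserving extension of a normalized fibre
trace. -/
theorem IsIntervalSubalgebra.exists_functional {A : Type*} [CStarAlgebra A]
    {S : NonUnitalStarSubalgebra ℂ A} {e : A} (hS : IsIntervalSubalgebra S e) {P Q : S}
    (hP : IsStarProjection P) (hQ : IsStarProjection Q) (hPQ : ¬ ProjSub P Q) :
    ∃ φ : StrongDual ℂ A, ‖φ‖ ≤ 1 ∧ φ e = 1 ∧ (∀ x ∈ S, ∀ y ∈ S, φ (x * y) = φ (y * x)) ∧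
      (∀ x ∈ S, 0 ≤ φ (star x * x)) ∧ (φ Q).re ≤ (φ P).re := by
  have : IsClosed (S : Set A) := hS.isClosed
  obtain ⟨m, n, k, l, hk, hl, ⟨ψ⟩⟩ := hS.exists_equiv
  have hψ : ∀ {X : S}, IsStarProjection X → IsStarProjection (ψ X) := fun h => h.map ψ
  obtain h | ⟨d, π, hd, hπ1, hlt⟩ := IntervalSum.projSub_or_exists_fibre hk hl (hψ hP) (hψ hQ)
  · exact absurd (by simpa using h.map ψ.symm) hPQ
  have hdpos : (0 : ℝ) < d := by exact_mod_cast hd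
  have hd0 : (d : ℂ) ≠ 0 := by exact_mod_cast hd.ne'
  let ρ : S →⋆ₙₐ[ℂ] Matrix (Fin d) (Fin d) ℂ := π.comp (ψ : S →⋆ₙₐ[ℂ] IntervalSum m n k l)
  have hρ : ∀ x, ρ x = π (ψ x) := fun x => rfl
  have hρe : ρ ⟨e, hS.unit_mem⟩ = 1 := by
    have h1 : ψ ⟨e, hS.unit_mem⟩ = 1 := by
      obtain ⟨u, hu⟩ : ∃ u, ψ u = 1 := ⟨ψ.symm 1, by simp⟩
      rw [← mul_one (ψ _), ← hu, ← map_mul]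
      exact congrArg ψ (Subtype.ext (hS.unit_mul _ u.2))
    rw [hρ, h1, hπ1]
  let t₀ : S.toSubmodule →ₗ[ℂ] ℂ :=
    { toFun := fun x => (d : ℂ)⁻¹ * (ρ x).trace
      map_add' := fun x y => by
        rw [← mul_add, ← Matrix.trace_add, ← map_add]
      map_smul' := fun c x => by
        have : ρ (c • x : S.toSubmodule) = c • ρ x := map_smul ρ c x
        rw [this, Matrix.trace_smul, smul_eq_mul, RingHom.id_apply, smul_eq_mul]
        ring }
  have ht₀ : ∀ x, ‖t₀ x‖ ≤ 1 * ‖x‖ := fun x => by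
    have h1 : ∀ y : S, ‖ρ y‖ ≤ ‖y‖ := NonUnitalStarAlgHom.norm_apply_le ρ
    calc ‖t₀ x‖ = (d : ℝ)⁻¹ * ‖(ρ x).trace‖ := by
          change ‖(d : ℂ)⁻¹ * (ρ x).trace‖ = _
          rw [norm_mul, norm_inv, Complex.norm_natCast]
      _ ≤ (d : ℝ)⁻¹ * (d * ‖x‖) := by
          gcongr
          exact (Matrix.norm_trace_le _).trans (mul_le_mul_of_nonneg_left (h1 x) hdpos.le)
      _ = 1 * ‖x‖ := by field_simp
  obtain ⟨φ, hφ, hφn⟩ := exists_extension_norm_eq S.toSubmodule (t₀.mkContinuous 1 ht₀)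
  have hφ' : ∀ x (hx : x ∈ S), φ x = (d : ℂ)⁻¹ * (ρ ⟨x, hx⟩).trace := fun x hx => hφ ⟨x, hx⟩
  refine ⟨φ, ?_, ?_, ?_, ?_, ?_⟩
  · rw [hφn]
    exact t₀.mkContinuous_norm_le zero_le_one ht₀
  · rw [hφ' e hS.unit_mem, hρe, Matrix.trace_one, Fintype.card_fin, inv_mul_cancel₀ hd0]
  · intro x hx y hy
    rw [hφ' _ (mul_mem hx hy), hφ' _ (mul_mem hy hx)]
    congr 1
    change (ρ (⟨x, hx⟩ * ⟨y, hy⟩)).trace = (ρ (⟨y, hy⟩ * ⟨x, hx⟩)).trace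
    rw [map_mul, map_mul, Matrix.trace_mul_comm]
  · intro x hx
    rw [hφ' _ (mul_mem (star_mem hx) hx)]
    have h1 : ρ ⟨star x * x, mul_mem (star_mem hx) hx⟩
        = (ρ ⟨x, hx⟩).conjTranspose * ρ ⟨x, hx⟩ := by
      rw [← Matrix.star_eq_conjTranspose, ← map_star, ← map_mul]; rfl
    rw [h1]
    refine mul_nonneg ?_ (Matrix.posSemidef_conjTranspose_mul_self _).trace_nonneg
    exact inv_nonneg.mpr (by exact_mod_cast hdpos.le)
  · rw [hφ' _ P.2, hφ' _ Q.2]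
    have h1 : (d : ℂ)⁻¹ = ((d : ℝ)⁻¹ : ℝ) := by push_cast; rfl
    rw [h1, Complex.re_ofReal_mul, Complex.re_ofReal_mul]
    exact mul_le_mul_of_nonneg_left hlt.le (inv_pos.mpr hdpos).le

/-! ### Tracial states as limits of almost tracial functionals -/

open Filter Topology

section Trace

variable {A : Type*} [CStarAlgebra A] [PartialOrder A] [StarOrderedRing A]

/-- Weak-⋆ compactness: a bounded net of functionals that is asymptotically unital, tracial and
positive has a cluster point, which is a tracial state. -/
theorem exists_tracialState_of_approx {ι : Type*} {l : Filter ι} [l.NeBot]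
    {φ : ι → StrongDual ℂ A} {C : ℝ} (hC : ∀ i, ‖φ i‖ ≤ C) (h1 : ∀ i, φ i 1 = 1)
    (htr : ∀ x y, ∀ δ > 0, ∀ᶠ i in l, ‖φ i (x * y) - φ i (y * x)‖ ≤ δ)
    (hpos : ∀ x, ∀ δ > 0, ∀ᶠ i in l, ∃ u : ℂ, 0 ≤ u ∧ ‖φ i (star x * x) - u‖ ≤ δ)
    {p q : A} (hpq : ∀ δ > 0, ∀ᶠ i in l, (φ i q).re ≤ (φ i p).re + δ) :
    ∃ τ : TracialState A, (τ.toPositiveLinearMap q).re ≤ (τ.toPositiveLinearMap p).re := by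
  let U : Ultrafilter ι := Ultrafilter.of l
  have hU : (U : Filter ι) ≤ l := Ultrafilter.of_le l
  obtain ⟨ψ, -, hψ⟩ := (WeakDual.isCompact_closedBall (0 : StrongDual ℂ A) C).ultrafilter_le_nhds'
    (U.map fun i => StrongDual.toWeakDual (φ i)) (by
      refine Filter.mem_map.mpr (Filter.univ_mem' fun i => ?_)
      simpa using hC i)
  have hlim : ∀ x, Tendsto (fun i => φ i x) U (𝓝 (ψ x)) := fun x =>
    ((WeakDual.eval_continuous x).tendsto ψ).comp hψ
  have hpos' : ∀ x : A, 0 ≤ x → 0 ≤ ψ x := fun x hx => by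
    obtain ⟨y, rfl⟩ := CStarAlgebra.nonneg_iff_eq_star_mul_self.mp hx
    have hcl : IsClosed {z : ℂ | 0 ≤ z} := isClosed_Ici
    refine hcl.closure_subset (Metric.mem_closure_iff.mpr fun δ hδ => ?_)
    have h2 : ∀ᶠ i in U, dist (φ i (star y * y)) (ψ (star y * y)) < δ / 2 :=
      Metric.tendsto_nhds.mp (hlim _) _ (half_pos hδ)
    obtain ⟨i, hi, u, hu, hiu⟩ := (h2.and (hU (hpos y (δ / 3) (by positivity)))).exists
    refine ⟨u, hu, ?_⟩
    rw [dist_comm] at hi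
    rw [← dist_eq_norm] at hiu
    linarith [dist_triangle (ψ (star y * y)) (φ i (star y * y)) u]
  let τ : TracialState A :=
    { PositiveLinearMap.mk₀ (WeakDual.toStrongDual ψ : A →ₗ[ℂ] ℂ) hpos' with
      map_one' := tendsto_nhds_unique (hlim 1) (by simp [h1])
      tracial' := fun x y => by
        have h2 := ((hlim (x * y)).sub (hlim (y * x))).norm
        refine sub_eq_zero.mp (norm_eq_zero.mp (le_antisymm ?_ (norm_nonneg _)))
        exact le_of_forall_pos_le_add fun δ hδ => by
          rw [zero_add]
          exact le_of_tendsto h2 (hU (htr x y δ hδ)) }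
  refine ⟨τ, le_of_forall_pos_le_add fun δ hδ => ?_⟩
  have hre : ∀ x, Tendsto (fun i => (φ i x).re) U (𝓝 (ψ x).re) := fun x =>
    (Complex.continuous_re.tendsto _).comp (hlim x)
  exact le_of_tendsto_of_tendsto (hre q) ((hre p).add_const δ) (hU (hpq δ hδ))

namespace TracialState

theorem map_one (τ : TracialState A) : τ.toPositiveLinearMap 1 = 1 := τ.map_one'

theorem map_mul_comm (τ : TracialState A) (x y : A) :
    τ.toPositiveLinearMap (x * y) = τ.toPositiveLinearMap (y * x) := τ.tracial' x y

theorem re_nonneg (τ : TracialState A) {p : A} (hp : IsStarProjection p) :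
    0 ≤ (τ.toPositiveLinearMap p).re :=
  (Complex.le_def.mp (τ.toPositiveLinearMap.map_nonneg hp.nonneg)).1

theorem norm_apply_le (τ : TracialState A) (x : A) : ‖τ.toPositiveLinearMap x‖ ≤ 4 * ‖x‖ := by
  obtain ⟨y, hy, hyn, hxy⟩ := CStarAlgebra.exists_sum_four_nonneg x
  conv_lhs => rw [hxy]
  simp only [map_sum, map_smul]
  refine (norm_sum_le _ _).trans ?_
  calc ∑ i : Fin 4, ‖Complex.I ^ (i : ℕ) • τ.toPositiveLinearMap (y i)‖ ≤ ∑ _i : Fin 4, ‖x‖ := by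
        refine Finset.sum_le_sum fun i _ => ?_
        have h := τ.toPositiveLinearMap.norm_apply_le_of_nonneg (y i) (hy i)
        rw [τ.map_one, norm_one, one_mul] at h
        rw [norm_smul, norm_pow, Complex.norm_I, one_pow, one_mul]
        exact h.trans (hyn i)
    _ = 4 * ‖x‖ := by simp

/-- A tracial state as a continuous functional. -/
noncomputable def toStrongDual (τ : TracialState A) : StrongDual ℂ A :=
  τ.toPositiveLinearMap.toLinearMap.mkContinuous 4 τ.norm_apply_le

theorem toStrongDual_apply (τ : TracialState A) (x : A) :
    τ.toStrongDual x = τ.toPositiveLinearMap x := rfl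

theorem norm_toStrongDual_le (τ : TracialState A) : ‖τ.toStrongDual‖ ≤ 4 :=
  LinearMap.mkContinuous_norm_le _ (by norm_num) _

/-- If the corner of `e` contains `n` orthogonal copies of `1 - e`, then `1 - e` is small in
trace. -/
theorem succ_mul_re_le_one (τ : TracialState A) {n : ℕ} {e : A} (he : IsStarProjection e)
    (h : MulClassLE n (1 - e) e) : (n + 1) * (τ.toPositiveLinearMap (1 - e)).re ≤ 1 := by
  obtain ⟨f, hf, hff⟩ := h
  have hτf : ∀ i, τ.toPositiveLinearMap (f i) = τ.toPositiveLinearMap (1 - e) := fun i => by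
    obtain ⟨-, -, v, hv1, hv2⟩ := hf i
    rw [← hv1, ← hv2, τ.map_mul_comm]
  have hef : ∀ i, e * f i = f i := fun i =>
    mul_mul_eq_of_mem_closure_cornerSet he (subset_closure (hf i).2.1)
  have hsum : IsStarProjection (∑ i, f i) := by
    refine ⟨?_, ?_⟩
    · rw [IsIdempotentElem, Finset.sum_mul_sum]
      refine Finset.sum_congr rfl fun i _ => ?_
      rw [Finset.sum_eq_single i (fun j _ hj => hff i j hj.symm) (by simp)]
      exact (hf i).1.isIdempotentElem.eq
    · rw [IsSelfAdjoint, star_sum]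
      exact Finset.sum_congr rfl fun i _ => (hf i).1.isSelfAdjoint.star_eq
  have hsub : IsStarProjection (e - ∑ i, f i) :=
    hsum.sub_of_mul_eq_right he (by rw [Finset.mul_sum]; exact Finset.sum_congr rfl fun i _ => hef i)
  have h1 := τ.re_nonneg hsub
  rw [map_sub, map_sum, Finset.sum_congr rfl fun i _ => hτf i] at h1
  have h2 : τ.toPositiveLinearMap e = 1 - τ.toPositiveLinearMap (1 - e) := by
    rw [map_sub, τ.map_one]; ring
  rw [h2] at h1
  simp at h1 ⊢
  linarith

end TracialState

end Trace

/-! ### Comparison up to a small projection in TAI algebras -/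

section Approx

variable {A : Type*} [CStarAlgebra A]

/-- Compressions by an almost central projection `e` are almost multiplicative. -/
theorem norm_compress_mul_sub_le {e x y a b : A} (he : IsStarProjection e) {ε : ℝ} (hε : ε ≤ 1)
    (hy : ‖y * e - e * y‖ ≤ ε) (ha : ‖e * x * e - a‖ ≤ ε) (hb : ‖e * y * e - b‖ ≤ ε) :
    ‖e * (x * y) * e - a * b‖ ≤ ε * (2 * ‖x‖ + ‖y‖ + 1) := by
  have he1 : ‖e‖ ≤ 1 := he.norm_le
  have hei := he.isIdempotentElem.eq
  have hε0 : 0 ≤ ε := (norm_nonneg _).trans hy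
  have hcomp : ∀ z, ‖e * z * e‖ ≤ ‖z‖ := fun z => by
    calc ‖e * z * e‖ ≤ ‖e‖ * ‖z‖ * ‖e‖ := (norm_mul_le _ _).trans (by gcongr; exact norm_mul_le _ _)
      _ ≤ 1 * ‖z‖ * 1 := by gcongr
      _ = ‖z‖ := by ring
  have han : ‖a‖ ≤ ‖x‖ + 1 := by
    have := norm_sub_le (e * x * e) (e * x * e - a)
    rw [sub_sub_cancel] at this
    linarith [hcomp x]
  have key : e * (x * y) * e - a * b = e * (x * (y * e - e * y)) * e
      + (e * x * e - a) * (e * y * e) + a * (e * y * e - b) := by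
    have h1 : e * (x * (y * e - e * y)) * e = e * (x * y) * (e * e) - e * x * e * y * e := by
      noncomm_ring
    have h2 : (e * x * e - a) * (e * y * e) = e * x * (e * e) * y * e - a * (e * y * e) := by
      noncomm_ring
    rw [h1, h2, hei, mul_sub]; abel
  rw [key]
  calc _ ≤ ‖e * (x * (y * e - e * y)) * e‖ + ‖(e * x * e - a) * (e * y * e)‖
        + ‖a * (e * y * e - b)‖ := norm_add₃_le
    _ ≤ ‖x‖ * ε + ε * ‖y‖ + (‖x‖ + 1) * ε := by
        gcongr
        · exact (hcomp _).trans ((norm_mul_le _ _).trans (by gcongr))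
        · exact (norm_mul_le _ _).trans (by gcongr; exact hcomp y)
        · exact (norm_mul_le _ _).trans (by gcongr)
    _ = _ := by ring

/-- The compression `e p e` of a projection by an almost central projection `e` is close to a
projection in any subalgebra that almost contains it. -/
theorem exists_isStarProjection_near_compress {S : NonUnitalStarSubalgebra ℂ A}
    (hS : IsClosed (S : Set A)) {e p y : A} (he : IsStarProjection e) (hp : IsStarProjection p)
    {ε : ℝ} (hε : ε ≤ 1 / 100) (hc : ‖p * e - e * p‖ ≤ ε) (hyS : y ∈ S)
    (hy : ‖e * p * e - y‖ ≤ ε) :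
    ∃ P : S, IsStarProjection P ∧ ‖(P : A) - e * p * e‖ ≤ 17 * ε := by
  have hε0 : 0 ≤ ε := (norm_nonneg _).trans hc
  have hes := he.isSelfAdjoint.star_eq
  have hps := hp.isSelfAdjoint.star_eq
  set x := e * p * e with hx
  have hxs : star x = x := by simp [hx, hes, hps, mul_assoc]
  have hx1 : ‖x‖ ≤ 1 := by
    calc ‖x‖ ≤ ‖e‖ * ‖p‖ * ‖e‖ := (norm_mul_le _ _).trans (by gcongr; exact norm_mul_le _ _)
      _ ≤ 1 * 1 * 1 := by gcongr <;> first | exact he.norm_le | exact hp.norm_le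
      _ = 1 := by ring
  have hys : ‖x - star y‖ ≤ ε := by
    rw [← norm_star, star_sub, star_star, hxs]; exact hy
  let z : S := (1 / 2 : ℂ) • (⟨y, hyS⟩ + star ⟨y, hyS⟩)
  have hzv : (z : A) = (1 / 2 : ℂ) • (y + star y) := rfl
  have hzs : IsSelfAdjoint z := by
    simp only [IsSelfAdjoint, z]
    rw [star_smul, star_add, star_star, add_comm]; simp
  have hxz : ‖x - z‖ ≤ ε := by
    have h1 : x - (z : A) = (1 / 2 : ℂ) • ((x - y) + (x - star y)) := by
      rw [hzv]; module
    rw [h1, norm_smul]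
    have := norm_add_le (x - y) (x - star y)
    norm_num
    linarith
  have hxx : ‖x * x - x‖ ≤ 4 * ε := by
    have h1 := norm_compress_mul_sub_le he (x := p) (y := p) (a := x) (b := x)
      (hε.trans (by norm_num)) hc (by simpa [hx] using hε0) (by simpa [hx] using hε0)
    rw [hp.isIdempotentElem.eq, ← hx, norm_sub_rev] at h1
    have hp1 : ‖p‖ ≤ 1 := hp.norm_le
    nlinarith
  have hz1 : ‖(z : A)‖ ≤ 1 + ε := by
    have := norm_sub_le x (x - z)
    rw [sub_sub_cancel] at this
    linarith
  have hzz' : ‖(z : A) * z - z‖ ≤ 8 * ε := by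
    have h1 : (z : A) * z - z = (x * x - x) - (x - z) * z - x * (x - z) + (x - z) := by
      noncomm_ring
    have h2 : ‖(x - z) * (z : A)‖ ≤ ε * (1 + ε) :=
      (norm_mul_le _ _).trans (by gcongr)
    have h3 : ‖x * (x - z)‖ ≤ 1 * ε := (norm_mul_le _ _).trans (by gcongr)
    rw [h1]
    calc _ ≤ ‖x * x - x‖ + ‖(x - z) * (z : A)‖ + ‖x * (x - z)‖ + ‖x - z‖ := by
          refine (norm_add_le _ _).trans ?_
          gcongr
          refine (norm_sub_le _ _).trans ?_
          gcongr
          exact norm_sub_le _ _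
      _ ≤ 8 * ε := by nlinarith
  have hzz : ‖z * z - z‖ ≤ 8 * ε := hzz'
  have : IsClosed (S : Set A) := hS
  obtain ⟨P, hP, hPz⟩ := exists_isStarProjection_norm_sub_le hzs (by linarith)
  refine ⟨P, hP, ?_⟩
  have hPz' : ‖(P : A) - z‖ ≤ 2 * ‖z * z - z‖ := hPz
  have h4 := norm_sub_le ((P : A) - z) (x - z)
  rw [sub_sub_sub_cancel_right] at h4
  linarith

end Approx

section TAI

variable {A : Type*} [CStarAlgebra A]

/-- The alternative for a single interval subalgebra `S` with unit `e` that is almost central and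
almost contains the compressions `e x e`, `x ∈ F`: either the part of `p` below `e` is subequivalent
to `q`, or a fibre trace of `S` gives a functional on the whole algebra that is almost tracial and
almost positive on `F`, and is almost at least as large at `p` as at `q`. -/
theorem IsIntervalSubalgebra.exists_comparison_or_functional {S : NonUnitalStarSubalgebra ℂ A}
    {e p q : A} (hS : IsIntervalSubalgebra S e) (he : IsStarProjection e)
    (hp : IsStarProjection p) (hq : IsStarProjection q) {F : Finset A} (hpF : p ∈ F) (hqF : q ∈ F)
    {ε : ℝ} (hε : ε ≤ 1 / 100) (hcomm : ∀ x ∈ F, ‖x * e - e * x‖ ≤ ε)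
    (happ : ∀ x ∈ F, ∃ y ∈ S, ‖e * x * e - y‖ ≤ ε) :
    (∃ P : A, IsStarProjection P ∧ e * P = P ∧ ‖P - e * p * e‖ < 1 ∧
      ProjSub p (P + (1 - e)) ∧ ProjSub P q) ∨
    ∃ φ : StrongDual ℂ A, ‖φ‖ ≤ 1 ∧ φ 1 = 1 ∧
      (∀ x ∈ F, ∀ y ∈ F, ‖φ (x * y) - φ (y * x)‖ ≤ ε * (3 * ‖x‖ + 3 * ‖y‖ + 2)) ∧
      (∀ x ∈ F, ∃ u : ℂ, 0 ≤ u ∧ ‖φ (star x * x) - u‖ ≤ ε * (3 * ‖x‖ + 1)) ∧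
      (φ q).re ≤ (φ p).re + 34 * ε := by
  have he1 : ‖e‖ ≤ 1 := he.norm_le
  have hei := he.isIdempotentElem.eq
  have hes := he.isSelfAdjoint.star_eq
  have hε0 : 0 ≤ ε := (norm_nonneg _).trans (hcomm p hpF)
  obtain ⟨yp, hypS, hyp⟩ := happ p hpF
  obtain ⟨yq, hyqS, hyq⟩ := happ q hqF
  obtain ⟨P, hP, hPp⟩ := exists_isStarProjection_near_compress hS.isClosed he hp hε
    (hcomm p hpF) hypS hyp
  obtain ⟨Q, hQ, hQq⟩ := exists_isStarProjection_near_compress hS.isClosed he hq hε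
    (hcomm q hqF) hyqS hyq
  have hPA : IsStarProjection (P : A) :=
    ⟨congrArg Subtype.val hP.isIdempotentElem.eq, congrArg Subtype.val hP.isSelfAdjoint.star_eq⟩
  have hQA : IsStarProjection (Q : A) :=
    ⟨congrArg Subtype.val hQ.isIdempotentElem.eq, congrArg Subtype.val hQ.isSelfAdjoint.star_eq⟩
  by_cases hPQ : ProjSub P Q
  · left
    have heP : e * (P : A) = P := hS.unit_mul _ P.2
    have hPe : (P : A) * e = P := hS.mul_unit _ P.2
    have hPQ' : ProjSub (P : A) (Q : A) := by
      obtain ⟨v, hv1, hv2, hv3⟩ := hPQ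
      exact ⟨v, congrArg Subtype.val hv1, congrArg Subtype.val hv2, congrArg Subtype.val hv3⟩
    refine ⟨P, hPA, heP, by linarith, ?_, hPQ'.trans ?_⟩
    · refine .of_norm_sub_lt_one hp (hPA.add he.one_sub ?_) ?_
      · rw [mul_sub, hPe, mul_one, sub_self]
      · have h1 : p - ((P : A) + (1 - e)) * p = e * (e * p - p * e) * p - (P - e * p * e) * p := by
          have h2 : e * (e * p - p * e) * p = (e * e) * p * p - e * p * e * p := by noncomm_ring
          rw [h2, hei, mul_assoc e p p, hp.isIdempotentElem.eq]; noncomm_ring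
        have h3 : ‖e * (e * p - p * e) * p‖ ≤ 1 * ε * 1 := by
          refine (norm_mul_le _ _).trans (mul_le_mul ?_ hp.norm_le (norm_nonneg _) (by linarith))
          refine (norm_mul_le _ _).trans (mul_le_mul he1 ?_ (norm_nonneg _) zero_le_one)
          rw [norm_sub_rev]; exact hcomm p hpF
        have h4 : ‖((P : A) - e * p * e) * p‖ ≤ 17 * ε * 1 :=
          (norm_mul_le _ _).trans (mul_le_mul hPp hp.norm_le (norm_nonneg _) (by linarith))
        rw [h1]
        linarith [norm_sub_le (e * (e * p - p * e) * p) (((P : A) - e * p * e) * p)]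
    · refine .of_norm_sub_lt_one hQA hq ?_
      have h1 : (Q : A) - q * Q
          = (1 - q) * (e * q - q * e) * e + (1 - q) * (Q - e * q * e) := by
        have h2 : (1 - q) * (e * q - q * e) * e
            = (1 - q) * (e * q * e) - ((1 - q) * q) * (e * e) := by noncomm_ring
        rw [h2, hq.one_sub_mul_self]; noncomm_ring
      have h1q : ‖1 - q‖ ≤ 1 := hq.one_sub.norm_le
      have h3 : ‖(1 - q) * (e * q - q * e) * e‖ ≤ 1 * ε * 1 := by
        refine (norm_mul_le _ _).trans (mul_le_mul ?_ he1 (norm_nonneg _) (by linarith))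
        refine (norm_mul_le _ _).trans (mul_le_mul h1q ?_ (norm_nonneg _) zero_le_one)
        rw [norm_sub_rev]; exact hcomm q hqF
      have h4 : ‖(1 - q) * ((Q : A) - e * q * e)‖ ≤ 1 * (17 * ε) :=
        (norm_mul_le _ _).trans (mul_le_mul h1q hQq (norm_nonneg _) zero_le_one)
      rw [h1]
      linarith [norm_add_le ((1 - q) * (e * q - q * e) * e) ((1 - q) * ((Q : A) - e * q * e))]
  · right
    obtain ⟨φ₀, hφn, hφe, hφtr, hφpos, hφPQ⟩ := hS.exists_functional hP hQ hPQ
    have hφle : ∀ x, ‖φ₀ x‖ ≤ ‖x‖ := fun x => φ₀.le_of_opNorm_le hφn x |>.trans (by simp)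
    -- The compression `x ↦ φ₀ (e x e)`.
    let φ : StrongDual ℂ A :=
      φ₀.comp ((ContinuousLinearMap.mul ℂ A e).comp ((ContinuousLinearMap.mul ℂ A).flip e))
    have hφ : ∀ x, φ x = φ₀ (e * x * e) := fun x => by
      simp [φ, mul_assoc]
    have happ2 : ∀ x ∈ F, ∀ y ∈ F, ∀ a b, ‖e * x * e - a‖ ≤ ε → ‖e * y * e - b‖ ≤ ε →
        ‖φ (x * y) - φ₀ (a * b)‖ ≤ ε * (2 * ‖x‖ + ‖y‖ + 1) := fun x _ y hy a b ha hb => by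
      rw [hφ, ← map_sub]
      exact (hφle _).trans (norm_compress_mul_sub_le he (by linarith) (hcomm y hy) ha hb)
    refine ⟨φ, ?_, ?_, ?_, ?_, ?_⟩
    · refine φ.opNorm_le_bound zero_le_one fun x => ?_
      rw [hφ]
      calc ‖φ₀ (e * x * e)‖ ≤ ‖e * x * e‖ := hφle _
        _ ≤ ‖e‖ * ‖x‖ * ‖e‖ := (norm_mul_le _ _).trans (by gcongr; exact norm_mul_le _ _)
        _ ≤ 1 * ‖x‖ * 1 := by gcongr
        _ = 1 * ‖x‖ := by ring
    · rw [hφ, mul_one, hei, hφe]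
    · intro x hx y hy
      obtain ⟨a, haS, ha⟩ := happ x hx
      obtain ⟨b, hbS, hb⟩ := happ y hy
      have h1 := happ2 x hx y hy a b ha hb
      have h2 := happ2 y hy x hx b a hb ha
      rw [hφtr b hbS a haS] at h2
      have h3 := norm_sub_le (φ (x * y) - φ₀ (a * b)) (φ (y * x) - φ₀ (a * b))
      rw [sub_sub_sub_cancel_right] at h3
      linarith
    · intro x hx
      obtain ⟨a, haS, ha⟩ := happ x hx
      refine ⟨φ₀ (star a * a), hφpos a haS, ?_⟩
      have ha' : ‖e * star x * e - star a‖ ≤ ε := by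
        rw [← norm_star]; simpa [hes, mul_assoc] using ha
      rw [hφ, ← map_sub]
      refine (hφle _).trans ((norm_compress_mul_sub_le he (by linarith) (hcomm x hx) ha' ha).trans
        (le_of_eq ?_))
      rw [norm_star]; ring
    · have h1 : ∀ z Z : A, ‖Z - e * z * e‖ ≤ 17 * ε → |(φ₀ Z).re - (φ z).re| ≤ 17 * ε :=
        fun z Z h => by
          rw [← Complex.sub_re, hφ, ← map_sub]
          exact (Complex.abs_re_le_norm _).trans ((hφle _).trans h)
      have h2 := abs_le.mp (h1 p P hPp)
      have h3 := abs_le.mp (h1 q Q hQq)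
      linarith [h2.1, h2.2, h3.1, h3.2]

theorem IsSimpleCStar.isFullElement (hA : IsSimpleCStar A) {a : A} (ha : a ≠ 0) :
    IsFullElement a := fun J hJ haJ => by
  refine (hA.2 J hJ).resolve_left fun h => ha ?_
  rw [h] at haJ
  exact (TwoSidedIdeal.mem_bot A).mp haJ

variable [PartialOrder A] [StarOrderedRing A]

/-- Comparison up to a small remainder: a projection `p` that is smaller than `q` in all traces is
dominated by `P + (1 - e)`, where `P` is subequivalent to `q` and `1 - e` is as small as the TAI
property permits. Otherwise the functionals attached to finer and finer approximations accumulate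
at a tracial state `τ` with `τ q ≤ τ p`. -/
theorem IsTAI.exists_comparison [Nontrivial A] (hA : IsTAI A) {p q : A}
    (hp : IsStarProjection p) (hq : IsStarProjection q)
    (hτ : ∀ τ : TracialState A, (τ.toPositiveLinearMap p).re < (τ.toPositiveLinearMap q).re)
    {n : ℕ} (hn : 0 < n) {a : A} (ha : 0 ≤ a) (haf : IsFullElement a) :
    ∃ e P : A, IsStarProjection e ∧ e ≠ 0 ∧ IsStarProjection P ∧ e * P = P ∧
      ‖P - e * p * e‖ < 1 ∧ ProjSub p (P + (1 - e)) ∧ ProjSub P q ∧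
      MulClassLE n (1 - e) e ∧ SubequivPos (1 - e) a := by
  classical
  by_contra! H
  let ε : ℕ → ℝ := fun m => 1 / ((m : ℝ) + 100)
  have hεpos : ∀ m, 0 < ε m := fun m => by positivity
  have hεle : ∀ m, ε m ≤ 1 / 100 := fun m =>
    one_div_le_one_div_of_le (by norm_num) (by linarith [Nat.cast_nonneg (α := ℝ) m])
  have hεlim : Tendsto ε atTop (𝓝 0) :=
    tendsto_const_nhds.div_atTop (tendsto_atTop_add_const_right _ _ tendsto_natCast_atTop_atTop)
  have hex : ∀ i : Finset A × ℕ, ∃ φ : StrongDual ℂ A, ‖φ‖ ≤ 1 ∧ φ 1 = 1 ∧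
      (∀ x ∈ i.1, ∀ y ∈ i.1, ‖φ (x * y) - φ (y * x)‖ ≤ ε i.2 * (3 * ‖x‖ + 3 * ‖y‖ + 2)) ∧
      (∀ x ∈ i.1, ∃ u : ℂ, 0 ≤ u ∧ ‖φ (star x * x) - u‖ ≤ ε i.2 * (3 * ‖x‖ + 1)) ∧
      (φ q).re ≤ (φ p).re + 34 * ε i.2 := by
    rintro ⟨F, m⟩
    obtain ⟨e, S, he, he0, hS, hcomm, happ, -, hmul, hsub⟩ :=
      hA (insert 1 (insert p (insert q F))) 1 (by simp) one_ne_zero (ε m) (hεpos m) n hn a ha haf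
    rcases hS.exists_comparison_or_functional he hp hq (by simp) (by simp) (hεle m)
      (fun x hx => (hcomm x hx).le) (fun x hx => by
        obtain ⟨y, hy, hxy⟩ := happ x hx; exact ⟨y, hy, hxy.le⟩) with
      ⟨P, hP, heP, hPn, hpP, hPq⟩ | ⟨φ, h1, h2, h3, h4, h5⟩
    · exact absurd hsub (H e P he he0 hP heP hPn hpP hPq hmul)
    · exact ⟨φ, h1, h2, fun x hx y hy => h3 x (by simp [hx]) y (by simp [hy]),
        fun x hx => h4 x (by simp [hx]), h5⟩
  choose φ hφ1 hφ2 hφ3 hφ4 hφ5 using hex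
  have hmem : ∀ x : A, ∀ᶠ i : Finset A × ℕ in atTop, x ∈ i.1 := fun x => by
    filter_upwards [eventually_ge_atTop (({x}, 0) : Finset A × ℕ)] with i hi
    exact hi.1 (Finset.mem_singleton_self x)
  have hsmall : ∀ C δ : ℝ, 0 < δ → ∀ᶠ i : Finset A × ℕ in atTop, ε i.2 * C ≤ δ := fun C δ hδ => by
    have h1 : Tendsto (fun i : Finset A × ℕ => ε i.2 * C) atTop (𝓝 (0 * C)) := by
      rw [← prod_atTop_atTop_eq]
      exact (hεlim.comp tendsto_snd).mul_const C
    rw [zero_mul] at h1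
    exact h1.eventually (eventually_le_nhds hδ)
  obtain ⟨τ, h⟩ := exists_tracialState_of_approx (l := atTop) (p := p) (q := q) hφ1 hφ2
    (fun x y δ hδ => by
      filter_upwards [hmem x, hmem y, hsmall _ δ hδ] with i hx hy hi
      exact (hφ3 i x hx y hy).trans hi)
    (fun x δ hδ => by
      filter_upwards [hmem x, hsmall _ δ hδ] with i hx hi
      obtain ⟨u, hu, hxu⟩ := hφ4 i x hx
      exact ⟨u, hu, hxu.trans hi⟩)
    (fun δ hδ => by
      filter_upwards [hsmall 34 δ hδ] with i hi
      linarith [hφ5 i])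
  exact absurd (hτ τ) (not_lt.mpr h)

/-- If the projections `r m ≤ q` have traces tending to zero uniformly, a strict inequality
`τ p < τ q` in all traces survives the passage from `q` to some `q - r m`. -/
theorem exists_forall_tracialState_lt_sub {p q : A}
    (hτ : ∀ τ : TracialState A, (τ.toPositiveLinearMap p).re < (τ.toPositiveLinearMap q).re)
    {r : ℕ → A} (hr : ∀ m : ℕ, ∀ τ : TracialState A,
      ((m : ℝ) + 1) * (τ.toPositiveLinearMap (r m)).re ≤ 1) :
    ∃ m, ∀ τ : TracialState A,
      (τ.toPositiveLinearMap p).re < (τ.toPositiveLinearMap (q - r m)).re := by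
  by_contra! H
  choose σ hσ using H
  obtain ⟨τ, h⟩ := exists_tracialState_of_approx (l := atTop) (p := p) (q := q)
    (φ := fun m => (σ m).toStrongDual) (fun m => (σ m).norm_toStrongDual_le)
    (fun m => (σ m).map_one)
    (fun x y δ hδ => .of_forall fun m => by
      simp only [TracialState.toStrongDual_apply, (σ m).map_mul_comm x y, sub_self, norm_zero]
      exact hδ.le)
    (fun x δ hδ => .of_forall fun m =>
      ⟨_, (σ m).toPositiveLinearMap.map_nonneg (star_mul_self_nonneg x), by
        simpa [TracialState.toStrongDual_apply] using hδ.le⟩)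
    (fun δ hδ => by
      filter_upwards [(tendsto_one_div_add_atTop_nhds_zero_nat (𝕜 := ℝ)).eventually
        (eventually_le_nhds hδ)] with m hm
      have h1 := hσ m
      have h2 : ((σ m).toPositiveLinearMap (r m)).re ≤ 1 / ((m : ℝ) + 1) := by
        rw [le_div_iff₀' (by positivity)]
        exact hr m (σ m)
      rw [map_sub, Complex.sub_re] at h1
      simp only [TracialState.toStrongDual_apply]
      linarith)
  exact absurd (hτ τ) (not_lt.mpr h)

end TAI

theorem theorem4p7 (A : Type*) [CStarAlgebra A] [PartialOrder A] [StarOrderedRing A]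
    (hsimple : IsSimpleCStar A) (hTAI : IsTAI A)
    (p q : A) (hp : IsStarProjection p) (hq : IsStarProjection q)
    (hτ : ∀ τ : TracialState A, (τ.toPositiveLinearMap p).re < (τ.toPositiveLinearMap q).re) :
    MvNSubequiv p q := by
  have : Nontrivial A := hsimple.1
  by_cases hq0 : q = 0
  · -- The hypothesis says that there is no tracial state, and comparing `1` with `0` is absurd.
    exfalso
    subst hq0
    have hno : ∀ τ : TracialState A, False := fun τ => by
      have h1 := hτ τ
      rw [map_zero, Complex.zero_re] at h1
      exact absurd (τ.re_nonneg hp) (not_le.mpr h1)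
    obtain ⟨e, P, he, he0, hP, -, hPe, -, ⟨v, hv1, -, hv3⟩, -⟩ :=
      hTAI.exists_comparison (p := 1) (q := 0) (.one A) (.zero A) (fun τ => (hno τ).elim) one_pos
        zero_le_one (hsimple.isFullElement one_ne_zero)
    have hP0 : P = 0 := by rw [← hv1, ← hv3, zero_mul, mul_zero]
    rw [hP0, mul_one, he.isIdempotentElem.eq, zero_sub, norm_neg] at hPe
    have h2 : ‖e‖ * ‖e‖ = ‖e‖ := by
      rw [← CStarRing.norm_star_mul_self, he.isSelfAdjoint.star_eq, he.isIdempotentElem.eq]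
    have h3 := norm_pos_iff.mpr he0
    nlinarith
  have hqf := hsimple.isFullElement hq0
  by_cases hcase : ∃ e P : A, e = 1 ∧ ProjSub p (P + (1 - e)) ∧ ProjSub P q
  · obtain ⟨e, P, rfl, h1, h2⟩ := hcase
    rw [sub_self, add_zero] at h1
    exact (h1.trans h2).mvNSubequiv hq
  -- Otherwise `q` dominates nonzero projections `r m` of trace at most `1 / (m + 2)`.
  have hr : ∀ m : ℕ, ∃ r : A, IsStarProjection r ∧ q * r = r ∧ r * q = r ∧ r ≠ 0 ∧
      ∀ τ : TracialState A, ((m : ℝ) + 1) * (τ.toPositiveLinearMap r).re ≤ 1 := fun m => by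
    obtain ⟨e, P, he, -, hP, -, -, hpP, hPq, hmul, hsub⟩ :=
      hTAI.exists_comparison hp hq hτ (n := m + 1) m.succ_pos hq.nonneg hqf
    obtain ⟨v, hv1, hr, hqr, hrq⟩ := (hsub.projSub he.one_sub hq).exists_isStarProjection hq
    refine ⟨v * star v, hr, hqr, hrq, fun h0 => ?_, fun τ => ?_⟩
    · have hv0 : v = 0 := by simpa using h0
      refine hcase ⟨e, P, ?_, hpP, hPq⟩
      rw [hv0, mul_zero] at hv1
      exact (sub_eq_zero.mp hv1.symm).symm
    · have h1 := τ.succ_mul_re_le_one he hmul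
      have h2 := τ.re_nonneg he.one_sub
      rw [τ.map_mul_comm, hv1]
      push_cast at h1
      linarith
  choose r hr hqr hrq hr0 hrτ using hr
  obtain ⟨m, hm⟩ := exists_forall_tracialState_lt_sub hτ hrτ
  have hqr' : IsStarProjection (q - r m) := (hr m).sub_of_mul_eq_left hq (hrq m)
  obtain ⟨e, P, he, -, hP, heP, -, hpP, hPq, -, hsub⟩ :=
    hTAI.exists_comparison hp hqr' hm one_pos (hr m).nonneg (hsimple.isFullElement (hr0 m))
  have hPe : P * (1 - e) = 0 := by
    have : P * e = P := by
      simpa [hP.isSelfAdjoint.star_eq, he.isSelfAdjoint.star_eq] using congrArg star heP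
    rw [mul_sub, mul_one, this, sub_self]
  have hqr0 : (q - r m) * r m = 0 := by
    rw [sub_mul, hqr, (hr m).isIdempotentElem.eq, sub_self]
  have h := ProjSub.add hP he.one_sub hqr' (hr m) hPe hqr0 hPq (hsub.projSub he.one_sub (hr m))
  rw [sub_add_cancel] at h
  exact (hpP.trans h).mvNSubequiv hq
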